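/- Let $\mathcal A$ be a (locally small) complete and cocomplete category, for instance a locally finitely presentable one, and let $C=\{(a_{ij}\colon A_i\to B_{ij})_{j\in J_i}\mid i\in I\}$ be a set of cones in $\mathcal A$ with all $A_i,B_{ij}$ finitely presentable and all $a_{ij}$ epimorphisms. An object $P$ is \emph{local} if for every $i\in I$ every map $A_i\to P$ factors through $a_{ij}$ for some $j\in J_i$; a map is \emph{admissible} if it has the right lifting property with respect to all $a_{ij}$. A \emph{localization} is a transfinite composition of pushouts of coproducts of maps $a_{ij}$; it is \emph{finite} if the composition and all the coproducts used are finite. A \emph{local form} of $R\in\mathcal A$ is a localization $R\to P$ with $P$ local. $\operatorname{Spec}R$ is the set of isomorphism classes (under $R$) of local forms of $R$, with the topology generated by the sets $\operatorname{Pts}(k)$, for all finite localizations $k\colon R\to K$, where $\operatorname{Pts}(k)$ consists of the classes of local forms that factor through $k$. \textbf{Theorem.} Assume that every cone in $C$ has finitely many components, i.e. that every $J_i$ is finite. Then for every $R\in\mathcal A$ the space $\operatorname{Spec}R$ is compact (every open cover has a finite subcover; no separation is required). The same holds for $\operatorname{Spec}R$ defined through its universal property. Assume in addition that for every topological space $T$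 the inclusion of $\mathcal A$-valued sheaves on $T$ into $\mathcal A$-valued presheaves on $T$ has a left adjoint. Let $(\mathcal A,\mathcal P)$-spaces be topological spaces with an $\mathcal A$-valued sheaf all of whose stalks are local, with the maps of such spaces that are admissible on all stalks. If an $(\mathcal A,\mathcal P)$-space $X$ with a map $\varepsilon\colon R\to\Gamma(X)$ to its global sections is such that, for every $(\mathcal A,\mathcal P)$-space $Y$, each map $R\to\Gamma(Y)$ equals $\Gamma(f)\circ\varepsilon$ for a unique map $f\colon Y\to X$ of $(\mathcal A,\mathcal P)$-spaces, then $X$ is compact. -/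

import Mathlib

universe v u

open CategoryTheory CategoryTheory.Limits Opposite TopologicalSpace

/-- A (small) set of cones `a i j : src i ⟶ tgt i j` in a category `A`, with `i` in a set `I`
and, for fixed `i`, with `j` in a possibly empty set `J i`. -/
structure ConeFamily (A : Type u) [Category.{v} A] where
  I : Type v
  J : I → Type v
  src : I → A
  tgt : (i : I) → J i → A
  a : (i : I) → (j : J i) → (src i ⟶ tgt i j)

namespace ConeFamily

section

variable {A : Type u} [Category.{v} A] (C : ConeFamily A)

/-- The collection of all components `a i j` of the cones. -/
def components : MorphismProperty A :=
  MorphismProperty.ofHoms (fun p : Sigma C.J => C.a p.1 p.2)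

/-- Local objects, i.e. the objects that are cone injective with respect to the cones. -/
def IsLocalObj (R : A) : Prop :=
  ∀ (i : C.I) (f : C.src i ⟶ R), ∃ (j : C.J i) (g : C.tgt i j ⟶ R), C.a i j ≫ g = f

/-- Admissible maps: the right lifting property with respect to all the components. -/
def admissible : MorphismProperty A :=
  C.components.rlp

/-- Localizations: transfinite compositions of pushouts of coproducts of components. -/
def localization : MorphismProperty A :=
  MorphismProperty.transfiniteCompositions.{v}
    (MorphismProperty.coproducts.{v} C.components).pushouts

/-- Finite coproducts of components. -/
def finiteCoproducts : MorphismProperty A :=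
  ⨆ n : ℕ, C.components.colimitsOfShape (Discrete (Fin n))

/-- Finite localizations: finite compositions of pushouts of finite coproducts of components.
Isomorphisms are included, as pushouts of the empty coproduct. -/
def finiteLocalization : MorphismProperty A :=
  C.finiteCoproducts.pushouts.multiplicativeClosure

/-- A local form of `R`: a localization `R ⟶ P` with `P` local. -/
structure LocalForm (R : A) where
  pt : A
  hom : R ⟶ pt
  isLocalization : C.localization hom
  isLocal : C.IsLocalObj pt

/-- Isomorphism of local forms of `R`, as objects under `R`. -/
def localFormSetoid (R : A) : Setoid (C.LocalForm R) where
  r p q := ∃ e : p.pt ≅ q.pt, p.hom ≫ e.hom = q.hom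
  iseqv :=
    { refl := fun p => ⟨Iso.refl _, by simp⟩
      symm := by
        rintro p q ⟨e, he⟩
        exact ⟨e.symm, by simp [← he]⟩
      trans := by
        rintro p q r ⟨e, he⟩ ⟨e', he'⟩
        exact ⟨e ≪≫ e', by simp [← he', ← he]⟩ }

/-- The underlying set of the spectrum of `R`: the isomorphism classes of local forms of `R`. -/
def Spec (R : A) : Type (max u v) :=
  Quotient (C.localFormSetoid R)

/-- The set of (isomorphism classes of) local forms of `R` that factor through `k : R ⟶ K`. -/
def pts {R K : A} (k : R ⟶ K) : Set (C.Spec R) :=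
  {x | ∃ p : C.LocalForm R, Quotient.mk (C.localFormSetoid R) p = x ∧
    ∃ g : K ⟶ p.pt, k ≫ g = p.hom}

/-- The topology of the spectrum of `R`, generated by the distinguished sets `pts k` for all
finite localizations `k` of `R`. -/
instance specTopology (R : A) : TopologicalSpace (C.Spec R) :=
  TopologicalSpace.generateFrom
    {U | ∃ (K : A) (k : R ⟶ K), C.finiteLocalization k ∧ U = C.pts k}

end

section

variable {A : Type u} [Category.{v} A] [HasColimits A] (C : ConeFamily A)

/-- `(A, P)`-spaces: spaces with an `A`-valued sheaf all of whose stalks are local. -/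
def IsAPSpace (X : AlgebraicGeometry.SheafedSpace.{u, v, v} A) : Prop :=
  ∀ x : X, C.IsLocalObj (X.presheaf.stalk x)

/-- Maps of `(A, P)`-spaces: those maps of `A`-spaces that are admissible on all stalks. -/
def IsAPMap {X Y : AlgebraicGeometry.SheafedSpace.{u, v, v} A} (f : X ⟶ Y) : Prop :=
  ∀ x : X, C.admissible (f.hom.stalkMap x)

/-- The `(A, P)`-space `X`, with `ε : R ⟶ Γ(X)`, is the value at `R` of a right adjoint of the
global sections functor from `(A, P)`-spaces to the opposite of `A`: maps of `(A, P)`-spaces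
`Y ⟶ X` correspond bijectively, through `ε`, to maps `R ⟶ Γ(Y)` in `A`. -/
structure IsSpectrum (R : A) (X : AlgebraicGeometry.SheafedSpace.{u, v, v} A)
    (ε : R ⟶ AlgebraicGeometry.SheafedSpace.Γ.obj (op X)) : Prop where
  isAPSpace : C.IsAPSpace X
  existsUnique : ∀ Y : AlgebraicGeometry.SheafedSpace.{u, v, v} A, C.IsAPSpace Y →
    ∀ g : R ⟶ AlgebraicGeometry.SheafedSpace.Γ.obj (op Y),
      ∃! f : Y ⟶ X, C.IsAPMap f ∧ ε ≫ AlgebraicGeometry.SheafedSpace.Γ.map f.op = g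

end

end ConeFamily

/-! Let the sets `Pts(k)`, for `k` in a family `𝒦`, cover the spectrum. Play a game with finitely
many moves: at `g : R ⟶ K`, stop if `g` factors through a member of `𝒦`, or else pick a map `A_i ⟶
K` and continue with the pushouts of `K` along all `a_ij`. `IsCovered` says that every branch can be
made to stop. As all `J_i` are finite, the game tree is finite, and a map from `R` to a local object
always follows one of its branches. So if `𝟙 R` is covered, finitely many members of `𝒦` suffice
(`IsCovered.exists_finite_of_isLocalObj`).

If `𝟙 R` is not covered, a local form missed by `𝒦` exists (`exists_localForm_of_not_isCovered`).
Being covered descends from a filtered colimit to a stage (`IsCovered.exists_of_isColimit`), so with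
Rado's selection principle all maps from the `A_i` to an uncovered `K` can be made to factor at once
without the result becoming covered (`exists_not_isCovered`). After `ω` rounds the colimit is local,
since the `A_i` are finitely presentable, and no member of `𝒦` maps to it under `R`, since such a
map would lift to a stage.

For the universal property, `TraceSpace` is a small space whose points record which finite
extensions of `R` a map to a local object factors through. It is compact for the same reason. The
sheafification of its natural structure presheaf makes it an `(A, P)`-space with a map from `R` to
its global sections, hence a map to `X`. That map is surjective: a point `x` gives `R ⟶ X_x`, whose
trace `y` has a stalk admissible over `X_x`, and testing on the one-point space with sheaf `X_x`
shows that `y` goes to `x`. So `X` is an image of a compact space. -/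

/-- The maps `k : X ⟶ K` such that, for a filtered diagram with a map from `X` to one of its stages,
every map under `X` from `K` to the colimit is induced by a map under `X` to a later stage. -/
def liftsAgainstFilteredColimits {A : Type u} [Category.{v} A] : MorphismProperty A :=
  fun X K k =>
    ∀ (J : Type v) [SmallCategory J] [IsFiltered J] (F : J ⥤ A) (L : A)
      (ι : F ⟶ (Functor.const J).obj L) (_ : IsColimit (Cocone.mk L ι)) (j : J) (x : X ⟶ F.obj j)
      (u : K ⟶ L), k ≫ u = x ≫ ι.app j →
      ∃ (j' : J) (h : j ⟶ j') (w : K ⟶ F.obj j'), k ≫ w = x ≫ F.map h ∧ w ≫ ι.app j' = u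

/-! ### Finite localizations lift to stages of filtered colimits. -/

section LiftsAgainstFilteredColimits

variable {A : Type u} [Category.{v} A]

theorem exists_lift_of_isFinitelyPresentable {J : Type v} [SmallCategory J] [IsFiltered J]
    {F : J ⥤ A} {L : A} {ι : F ⟶ (Functor.const J).obj L} (hc : IsColimit (Cocone.mk L ι))
    {S : A} (hS : IsFinitelyPresentable.{v} S) (j₀ : J) (f : S ⟶ L) :
    ∃ (j : J) (_ : j₀ ⟶ j) (w : S ⟶ F.obj j), w ≫ ι.app j = f := by
  obtain ⟨j, w, hw⟩ := IsFinitelyPresentable.exists_hom_of_isColimit hc f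
  refine ⟨IsFiltered.max j₀ j, IsFiltered.leftToMax _ _, w ≫ F.map (IsFiltered.rightToMax _ _), ?_⟩
  have := ι.naturality (IsFiltered.rightToMax j₀ j)
  simp at this
  simpa [this] using hw

/-- Presentability of `B` lifts `u` to a stage. The two maps from `S` to that stage agree in the
colimit, so presentability of `S` makes them agree later. -/
theorem liftsAgainstFilteredColimits_of_isFinitelyPresentable {S B : A} (a : S ⟶ B)
    (hS : IsFinitelyPresentable.{v} S) (hB : IsFinitelyPresentable.{v} B) :
    liftsAgainstFilteredColimits a := by
  intro J _ _ F L ι hc j x u hu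
  obtain ⟨j₁, h₁, w, hw⟩ := exists_lift_of_isFinitelyPresentable hc hB j u
  have nat : ∀ {p q : J} (h : p ⟶ q), F.map h ≫ ι.app q = ι.app p := fun h => by
    simp
  obtain ⟨k, s, t, hst⟩ := IsFinitelyPresentable.exists_eq_of_isColimit hc (a ≫ w)
    (x ≫ F.map h₁) (by simp [hw, hu, nat])
  obtain ⟨l, m, hm⟩ : ∃ (l : J) (m : k ⟶ l), s ≫ m = t ≫ m :=
    ⟨_, IsFiltered.coeqHom s t, IsFiltered.coeq_condition s t⟩
  refine ⟨l, h₁ ≫ t ≫ m, w ≫ F.map (s ≫ m), ?_, by simp [nat, hw]⟩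
  have := congr($hst ≫ F.map m)
  simpa using this

instance : (liftsAgainstFilteredColimits (A := A)).IsMultiplicative where
  id_mem X := by
    intro J _ _ F L ι hc j x u hu
    exact ⟨j, 𝟙 j, x, by simp, by simpa using hu.symm⟩
  comp_mem k l hk hl := by
    intro J _ _ F L ι hc j x u hu
    obtain ⟨j₁, h₁, w₁, e₁, e₁'⟩ := hk J F L ι hc j x (l ≫ u) (by simpa using hu)
    obtain ⟨j₂, h₂, w₂, e₂, e₂'⟩ := hl J F L ι hc j₁ w₁ u e₁'.symm
    exact ⟨j₂, h₁ ≫ h₂, w₂, by simp [e₂, reassoc_of% e₁], e₂'⟩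

instance : (liftsAgainstFilteredColimits (A := A)).IsStableUnderCobaseChange where
  of_isPushout {S B X K a f k g} sq ha := by
    intro J _ _ F L ι hc j x u hu
    obtain ⟨j', h, w, e, e'⟩ := ha J F L ι hc j (f ≫ x) (g ≫ u)
      (by rw [← sq.w_assoc]; simp [hu])
    have nat : F.map h ≫ ι.app j' = ι.app j := by simp
    refine ⟨j', h, sq.desc (x ≫ F.map h) w (by simp [e]), by simp, ?_⟩
    apply sq.hom_ext
    · simp [nat, hu]
    · simp [e']

end LiftsAgainstFilteredColimits

namespace ConeFamily

variable {A : Type u} [Category.{v} A]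

theorem finiteLocalization_le_liftsAgainstFilteredColimits (C : ConeFamily A)
    (hsrc : ∀ i, IsFinitelyPresentable.{v} (C.src i))
    (htgt : ∀ i j, IsFinitelyPresentable.{v} (C.tgt i j)) :
    C.finiteLocalization ≤ liftsAgainstFilteredColimits := by
  refine (MorphismProperty.multiplicativeClosure_le_iff _ _).2 ?_
  refine MorphismProperty.pushouts_le_iff.2 (iSup_le fun n => ?_)
  -- Finite coproducts of finitely presentable objects are finitely presentable, which reduces the
  -- claim to a map between such objects.
  rintro _ _ _ ⟨X₁, X₂, c₁, c₂, h₁, h₂, f, hf⟩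
  have key : ∀ s : Discrete (Fin n), IsFinitelyPresentable.{v} (X₁.obj s) ∧
      IsFinitelyPresentable.{v} (X₂.obj s) := by
    intro s
    have := hf s
    rw [components, MorphismProperty.ofHoms_iff] at this
    obtain ⟨p, hp⟩ := this
    have e₁ : X₁.obj s = C.src p.1 := congr(($hp).left)
    have e₂ : X₂.obj s = C.tgt p.1 p.2 := congr(($hp).right)
    exact ⟨e₁ ▸ hsrc _, e₂ ▸ htgt _ _⟩
  have : Fact Cardinal.aleph0.{v}.IsRegular := Cardinal.fact_isRegular_aleph0
  have fin : HasCardinalLT (Arrow (Discrete (Fin n))) Cardinal.aleph0.{v} := by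
    rw [hasCardinalLT_arrow_discrete_iff, hasCardinalLT_aleph0_iff]
    infer_instance
  apply liftsAgainstFilteredColimits_of_isFinitelyPresentable
  · have := fun s => (key s).1
    exact isCardinalPresentable_of_isColimit.{v} _ h₁ _ fin
  · have := fun s => (key s).2
    exact isCardinalPresentable_of_isColimit.{v} _ h₂ _ fin

end ConeFamily

/-! ### Pushouts of filtered colimits along epimorphisms. -/

section PushoutColimit

variable {A : Type u} [Category.{v} A] [HasPushouts A] {J : Type v} [SmallCategory J]

/-- The diagram of the pushouts along `a` of the stages of the diagram `F` after `j`. -/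
noncomputable def pushoutDiagram (F : J ⥤ A) {j : J} {S B : A} (f : S ⟶ F.obj j) (a : S ⟶ B) :
    Under j ⥤ A where
  obj Y := pushout (f ≫ F.map Y.hom) a
  map {Y Z} φ := pushout.desc (F.map φ.right ≫ pushout.inl _ _) (pushout.inr _ _) (by
    have e : F.map Y.hom ≫ F.map φ.right = F.map Z.hom := by rw [← Functor.map_comp, Under.w φ]
    rw [← pushout.condition, Category.assoc, reassoc_of% e, Category.assoc])
  map_id Y := by
    apply pushout.hom_ext
    · rw [pushout.inl_desc]
      simp
    · rw [pushout.inr_desc, Category.comp_id]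
  map_comp φ ψ := by
    apply pushout.hom_ext
    · rw [pushout.inl_desc, pushout.inl_desc_assoc, Category.assoc, pushout.inl_desc]
      simp
    · rw [pushout.inr_desc, pushout.inr_desc_assoc, pushout.inr_desc]

/-- The first inclusion into a stage of `pushoutDiagram`. -/
noncomputable def pushoutDiagramInl (F : J ⥤ A) {j : J} {S B : A} (f : S ⟶ F.obj j) (a : S ⟶ B)
    (Y : Under j) : F.obj Y.right ⟶ (pushoutDiagram F f a).obj Y :=
  pushout.inl _ _

/-- The second inclusion into a stage of `pushoutDiagram`. -/
noncomputable def pushoutDiagramInr (F : J ⥤ A) {j : J} {S B : A} (f : S ⟶ F.obj j) (a : S ⟶ B)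
    (Y : Under j) : B ⟶ (pushoutDiagram F f a).obj Y :=
  pushout.inr _ _

variable {F : J ⥤ A} {L : A} (ι : F ⟶ (Functor.const J).obj L) {j : J} {S B : A}
  (f : S ⟶ F.obj j) (a : S ⟶ B)

instance [Epi a] (Y : Under j) : Epi (pushoutDiagramInl F f a Y) :=
  inferInstanceAs (Epi (pushout.inl _ _))

theorem pushoutDiagram_condition (Y : Under j) :
    f ≫ F.map Y.hom ≫ pushoutDiagramInl F f a Y = a ≫ pushoutDiagramInr F f a Y := by
  rw [← Category.assoc]
  exact pushout.condition

variable (F) in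
theorem pushoutDiagramInl_map {Y Z : Under j} (φ : Y ⟶ Z) :
    pushoutDiagramInl F f a Y ≫ (pushoutDiagram F f a).map φ =
      F.map φ.right ≫ pushoutDiagramInl F f a Z :=
  pushout.inl_desc _ _ _

/-- The map from a stage of `pushoutDiagram F f a` to the pushout of the colimit of `F`. -/
noncomputable def pushoutDiagramToPushout (Y : Under j) :
    (pushoutDiagram F f a).obj Y ⟶ pushout (f ≫ ι.app j) a :=
  pushout.desc (ι.app Y.right ≫ pushout.inl _ _) (pushout.inr _ _) (by
    have e : F.map Y.hom ≫ ι.app Y.right = ι.app j := by simp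
    rw [← pushout.condition, Category.assoc, reassoc_of% e, Category.assoc])

theorem pushoutDiagramInl_toPushout (Y : Under j) :
    pushoutDiagramInl F f a Y ≫ pushoutDiagramToPushout ι f a Y =
      ι.app Y.right ≫ pushout.inl (f ≫ ι.app j) a :=
  pushout.inl_desc _ _ _

/-- The natural map from `pushoutDiagram F f a` to the pushout of the colimit of `F`. -/
noncomputable def pushoutDiagramι [Epi a] :
    pushoutDiagram F f a ⟶ (Functor.const (Under j)).obj (pushout (f ≫ ι.app j) a) where
  app Y := pushoutDiagramToPushout ι f a Y
  naturality Y Z φ := by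
    have e : F.map φ.right ≫ ι.app Z.right = ι.app Y.right := by simp
    have h : (pushoutDiagram F f a).map φ ≫ pushoutDiagramToPushout ι f a Z =
        pushoutDiagramToPushout ι f a Y := by
      rw [← cancel_epi (pushoutDiagramInl F f a Y), reassoc_of% pushoutDiagramInl_map F f a φ,
        pushoutDiagramInl_toPushout, pushoutDiagramInl_toPushout, reassoc_of% e]
    exact h.trans (Category.comp_id _).symm

theorem pushoutDiagramInl_ι [Epi a] (Y : Under j) :
    pushoutDiagramInl F f a Y ≫ (pushoutDiagramι ι f a).app Y =
      ι.app Y.right ≫ pushout.inl (f ≫ ι.app j) a :=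
  pushout.inl_desc _ _ _

/-- Pushouts along an epimorphism commute with filtered colimits. -/
noncomputable def isColimitPushoutDiagram [IsFiltered J] [Epi a] (hc : IsColimit (Cocone.mk L ι)) :
    IsColimit (Cocone.mk _ (pushoutDiagramι ι f a)) := by
  -- The stages after `j` form a final subdiagram, so they have the same colimit.
  let hc' : IsColimit ((Cocone.mk L ι).whisker (Under.forget j)) :=
    (Functor.Final.isColimitWhiskerEquiv (Under.forget j) _).symm hc
  let t (s : Cocone (pushoutDiagram F f a)) : Cocone (Under.forget j ⋙ F) :=
    { pt := s.pt
      ι :=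
        { app := fun Y => pushoutDiagramInl F f a Y ≫ s.ι.app Y
          naturality := fun Y Z φ => by
            refine ((reassoc_of% pushoutDiagramInl_map F f a φ) (s.ι.app Z)).symm.trans ?_
            rw [s.w φ]
            exact (Category.comp_id _).symm } }
  have fac (s) (Y : Under j) : ι.app Y.right ≫ hc'.desc (t s) =
      pushoutDiagramInl F f a Y ≫ s.ι.app Y := hc'.fac (t s) Y
  have fac₀ (s) : (f ≫ ι.app j) ≫ hc'.desc (t s) =
      a ≫ pushoutDiagramInr F f a (Under.mk (𝟙 j)) ≫ s.ι.app (Under.mk (𝟙 j)) := by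
    rw [← reassoc_of% pushoutDiagram_condition f a (Under.mk (𝟙 j)), ← fac]
    simp
  exact
    { desc := fun s => pushout.desc (hc'.desc (t s)) _ (fac₀ s)
      fac := fun s Y => by
        rw [← cancel_epi (pushoutDiagramInl F f a Y), ← fac,
          reassoc_of% pushoutDiagramInl_ι ι f a Y,
          pushout.inl_desc]
      uniq := fun s m hm => by
        rw [← cancel_epi (pushout.inl (f ≫ ι.app j) a), pushout.inl_desc]
        apply hc'.hom_ext
        intro Y
        refine Eq.trans ?_ (fac s Y).symm
        rw [← hm Y, reassoc_of% pushoutDiagramInl_ι ι f a Y]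
        rfl }

end PushoutColimit

/-! ### Finite case distinctions. -/

namespace ConeFamily

variable {A : Type u} [Category.{v} A] [HasPushouts A] (C : ConeFamily A) {R : A}

/-- A map `g : R ⟶ K` is covered by the family `𝒦` of objects under `R` if, after finitely many
case distinctions according to the cones, `g` factors through members of `𝒦`. -/
inductive IsCovered (𝒦 : Set (Under R)) : ∀ {K : A}, (R ⟶ K) → Prop
  | base {K : A} (g : R ⟶ K) (k : Under R) (hk : k ∈ 𝒦) (u : k.right ⟶ K) (hu : k.hom ≫ u = g) :
      IsCovered 𝒦 g
  | step {K : A} (g : R ⟶ K) (i : C.I) (f : C.src i ⟶ K)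
      (h : ∀ j, IsCovered 𝒦 (g ≫ pushout.inl f (C.a i j))) : IsCovered 𝒦 g

variable {C} {𝒦 : Set (Under R)}

theorem IsCovered.comp {K : A} {g : R ⟶ K} (hg : C.IsCovered 𝒦 g) :
    ∀ {L : A} (h : K ⟶ L), C.IsCovered 𝒦 (g ≫ h) := by
  induction hg with
  | base g k hk u hu =>
    intro L h
    exact .base _ k hk (u ≫ h) (by rw [reassoc_of% hu])
  | step g i f _ ih =>
    intro L h
    refine .step _ i (f ≫ h) fun j => ?_
    have := ih j (pushout.desc (h ≫ pushout.inl (f ≫ h) (C.a i j)) (pushout.inr _ _)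
      (by rw [← pushout.condition, Category.assoc]))
    rw [Category.assoc, pushout.inl_desc] at this
    rwa [Category.assoc]

/-- At each case distinction, locality of `P` selects a branch `j` over which `h` extends. Finitely
many branches, each with a finite family, leave a finite family. -/
theorem IsCovered.exists_finite_of_isLocalObj (hfin : ∀ i, Finite (C.J i)) {K : A} {g : R ⟶ K}
    (hg : C.IsCovered 𝒦 g) :
    ∃ 𝒦' ⊆ 𝒦, 𝒦'.Finite ∧ ∀ (P : A) (_ : C.IsLocalObj P) (h : K ⟶ P),
      ∃ k ∈ 𝒦', ∃ u : k.right ⟶ P, k.hom ≫ u = g ≫ h := by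
  induction hg with
  | base g k hk u hu =>
    exact ⟨{k}, by simpa using hk, Set.finite_singleton k, fun P _ h =>
      ⟨k, rfl, u ≫ h, by rw [reassoc_of% hu]⟩⟩
  | step g i f _ ih =>
    have := hfin i
    choose 𝒦' h₁ h₂ h₃ using ih
    refine ⟨⋃ j, 𝒦' j, by simpa using h₁, Set.finite_iUnion h₂, fun P hP h => ?_⟩
    obtain ⟨j, b, hb⟩ := hP i (f ≫ h)
    obtain ⟨k, hk, u, hu⟩ := h₃ j P hP (pushout.desc h b hb.symm)
    exact ⟨k, Set.mem_iUnion_of_mem j hk, u, by rw [hu, Category.assoc, pushout.inl_desc]⟩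

/-- At a case distinction, `f` lifts to a stage because its source is finitely presentable. The
pushouts of `L` are then filtered colimits of pushouts of stages, so by induction each branch is
covered at some stage; finitely many branches have a common one. -/
theorem IsCovered.exists_of_isColimit (hsrc : ∀ i, IsFinitelyPresentable.{v} (C.src i))
    (hepi : ∀ i j, Epi (C.a i j)) (hfin : ∀ i, Finite (C.J i))
    (h𝒦 : ∀ k ∈ 𝒦, liftsAgainstFilteredColimits k.hom) {L : A} {l : R ⟶ L}
    (hl : C.IsCovered 𝒦 l) :
    ∀ {J : Type v} [SmallCategory J] [IsFiltered J] {F : J ⥤ A}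
      {ι : F ⟶ (Functor.const J).obj L} (_ : IsColimit (Cocone.mk L ι)) {j : J}
      (g : R ⟶ F.obj j), g ≫ ι.app j = l →
      ∃ (j' : J) (h : j ⟶ j'), C.IsCovered 𝒦 (g ≫ F.map h) := by
  induction hl with
  | base l k hk u hu =>
    intro J _ _ F ι hc j g hg
    obtain ⟨j', h, w, hw, -⟩ := h𝒦 k hk J F _ ι hc j g u (hu.trans hg.symm)
    exact ⟨j', h, .base _ k hk w hw⟩
  | @step L l i f _ ih =>
    intro J _ _ F ι hc j g hg
    obtain ⟨j₁, h₁, f, rfl⟩ := exists_lift_of_isFinitelyPresentable hc (hsrc i) j f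
    have nat : F.map h₁ ≫ ι.app j₁ = ι.app j := by simp
    have key (s : C.J i) : ∃ Y : Under j₁,
        C.IsCovered 𝒦 (g ≫ F.map h₁ ≫ F.map Y.hom ≫ pushoutDiagramInl F f (C.a i s) Y) := by
      have := hepi i s
      obtain ⟨Y, h, hY⟩ := ih s (isColimitPushoutDiagram ι f (C.a i s) hc)
        (g ≫ F.map h₁ ≫ pushoutDiagramInl F f (C.a i s) (Under.mk (𝟙 j₁))) (by
          subst hg
          simp only [Category.assoc, pushoutDiagramInl_ι]
          rw [← nat]
          simp only [Category.assoc]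
          rfl)
      refine ⟨Y, ?_⟩
      have e : h.right = Y.hom := by
        have := Under.w h
        simpa using this
      simpa only [Category.assoc, pushoutDiagramInl_map, e] using hY
    choose Y hY using key
    have := hfin i
    obtain ⟨Z, hZ⟩ := IsFiltered.sup_objs_exists (Set.finite_range Y).toFinset
    refine ⟨Z.right, h₁ ≫ Z.hom, .step _ i (f ≫ F.map Z.hom) fun s => ?_⟩
    obtain ⟨φ⟩ := hZ (X := Y s) (by simp)
    have := (hY s).comp ((pushoutDiagram F f (C.a i s)).map φ)
    have e : F.map (Y s).hom ≫ F.map φ.right = F.map Z.hom := by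
      rw [← Functor.map_comp, Under.w φ]
    simp only [Category.assoc, pushoutDiagramInl_map, reassoc_of% e] at this
    rw [Functor.map_comp]
    simp only [Category.assoc]
    exact this

end ConeFamily

/-! ### Filtered diagrams of quotients of a fixed object. -/

section EpiDiagram

variable {A : Type u} [Category.{v} A] {K : A} {J : Type*} [Category J] {X : J → A}
  (e : ∀ j, K ⟶ X j) [∀ j, Epi (e j)] (he : ∀ ⦃i j⦄, (i ⟶ j) → ∃ u, e i ≫ u = e j)

/-- A family of epimorphisms out of `K` such that `e j` factors through `e i` whenever there
is a map `i ⟶ j` is a diagram. -/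
noncomputable def epiDiagram : J ⥤ A where
  obj := X
  map h := (he h).choose
  map_id j := by
    rw [← cancel_epi (e j), (he (𝟙 j)).choose_spec]
    simp
  map_comp {i j k} h h' := by
    rw [← cancel_epi (e i), (he (h ≫ h')).choose_spec,
      reassoc_of% (he h).choose_spec, (he h').choose_spec]

/-- The given map from `K` to a stage of `epiDiagram`. -/
def toEpiDiagram (j : J) : K ⟶ (epiDiagram e he).obj j := e j

instance (j : J) : Epi (toEpiDiagram e he j) := inferInstanceAs (Epi (e j))

theorem toEpiDiagram_map {i j : J} (h : i ⟶ j) :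
    toEpiDiagram e he i ≫ (epiDiagram e he).map h = toEpiDiagram e he j :=
  (he h).choose_spec

variable {L : A} (l : K ⟶ L) (hl : ∀ j, ∃ u, e j ≫ u = l)

/-- The cocone of an epimorphic diagram induced by a map out of `K` that factors through all
members of the diagram. -/
noncomputable def epiDiagramι : epiDiagram e he ⟶ (Functor.const J).obj L where
  app j := (hl j).choose
  naturality i j h := by
    have h₁ : e i ≫ (he h).choose ≫ (hl j).choose = e i ≫ (hl i).choose := by
      rw [reassoc_of% (he h).choose_spec, (hl j).choose_spec, (hl i).choose_spec]
    rw [cancel_epi] at h₁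
    exact h₁.trans (Category.comp_id _).symm

theorem toEpiDiagram_ι_app (j : J) :
    toEpiDiagram e he j ≫ (epiDiagramι e he l hl).app j = l :=
  (hl j).choose_spec

/-- All maps out of `K` that a cocone of an epimorphic filtered diagram induces are equal. -/
theorem toEpiDiagram_comp_eq [IsFiltered J] (s : Cocone (epiDiagram e he)) (i j : J) :
    toEpiDiagram e he i ≫ s.ι.app i = toEpiDiagram e he j ≫ s.ι.app j := by
  have h {i j : J} (f : i ⟶ j) :
      toEpiDiagram e he i ≫ s.ι.app i = toEpiDiagram e he j ≫ s.ι.app j := by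
    rw [← s.w f, reassoc_of% toEpiDiagram_map e he f]
  rw [h (IsFiltered.leftToMax i j), h (IsFiltered.rightToMax i j)]

/-- The cocone of an epimorphic filtered diagram is colimiting if it is universal among the maps
out of `K`. -/
noncomputable def isColimitEpiDiagram [IsFiltered J] [Epi l]
    (H : ∀ {Y : A} (h : K ⟶ Y), (∀ j, ∃ u, e j ≫ u = h) → ∃ u, l ≫ u = h) :
    IsColimit (Cocone.mk L (epiDiagramι e he l hl)) := by
  have := IsFiltered.nonempty (C := J)
  have ex (s : Cocone (epiDiagram e he)) :
      ∃ u : L ⟶ s.pt, ∀ j, l ≫ u = toEpiDiagram e he j ≫ s.ι.app j := by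
    obtain ⟨u, hu⟩ := H (toEpiDiagram e he (Classical.arbitrary J) ≫ s.ι.app _)
      fun j => ⟨_, toEpiDiagram_comp_eq e he s j _⟩
    exact ⟨u, fun j => hu.trans (toEpiDiagram_comp_eq e he s _ j)⟩
  exact
    { desc := fun s => (ex s).choose
      fac := fun s j => by
        rw [← cancel_epi (toEpiDiagram e he j), ← (ex s).choose_spec j,
          reassoc_of% toEpiDiagram_ι_app e he l hl j]
      uniq := fun s m hm => by
        rw [← cancel_epi l, (ex s).choose_spec (Classical.arbitrary J), ← hm,
          reassoc_of% toEpiDiagram_ι_app e he l hl _] }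

end EpiDiagram

/-! ### Solving all problems with values in `K` at once. -/

namespace ConeFamily

section Choice

variable {A : Type u} [Category.{v} A] [HasColimits A] (C : ConeFamily A)

/-- The maps from the sources of the cones to `K`. -/
abbrev Problem (K : A) : Type v := Σ i, (C.src i ⟶ K)

variable {C} {K : A} (c : ∀ d : C.Problem K, C.J d.1) (S : Set (C.Problem K))

/-- The pushout of `K` along the coproduct of the components chosen by `c`, for all `d ∈ S`. -/
noncomputable abbrev choicePushout : A :=
  pushout (Limits.Sigma.desc fun d : S => d.1.2) (Limits.Sigma.map fun d : S => C.a d.1.1 (c d.1))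

/-- The map from `K` to `choicePushout c S`. -/
noncomputable abbrev choiceInl : K ⟶ choicePushout c S := pushout.inl _ _

variable {S} in
theorem exists_comp_choiceInl {d : C.Problem K} (hd : d ∈ S) :
    ∃ b, C.a d.1 (c d) ≫ b = d.2 ≫ choiceInl c S := by
  refine ⟨Limits.Sigma.ι (fun d : S => C.tgt d.1.1 (c d.1)) ⟨d, hd⟩ ≫ pushout.inr _ _, ?_⟩
  have := congr(Limits.Sigma.ι (fun d : S => C.src d.1.1) ⟨d, hd⟩ ≫
    $(pushout.condition (f := Limits.Sigma.desc fun d : S => d.1.2)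
      (g := Limits.Sigma.map fun d : S => C.a d.1.1 (c d.1))))
  rw [Limits.Sigma.ι_map_assoc, Limits.Sigma.ι_desc_assoc] at this
  exact this.symm

theorem exists_choiceInl_comp {Y : A} (h : K ⟶ Y)
    (H : ∀ d ∈ S, ∃ b, C.a d.1 (c d) ≫ b = d.2 ≫ h) : ∃ u, choiceInl c S ≫ u = h := by
  choose b hb using fun d : S => H d.1 d.2
  refine ⟨pushout.desc h (Limits.Sigma.desc b) ?_, pushout.inl_desc _ _ _⟩
  apply Limits.Sigma.hom_ext
  intro d
  simp [hb d]

theorem epi_choiceInl (hepi : ∀ i j, Epi (C.a i j)) : Epi (choiceInl c S) := by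
  have (d : S) : Epi (C.a d.1.1 (c d.1)) := hepi _ _
  infer_instance

theorem choiceInl_mem_pushouts :
    (MorphismProperty.coproducts.{v} C.components).pushouts (choiceInl c S) := by
  refine MorphismProperty.pushouts_mk _
    (IsPushout.of_hasPushout (Limits.Sigma.desc fun d : S => d.1.2) _) ?_
  refine MorphismProperty.colimitsOfShape_le_coproducts _ S _ ?_
  refine MorphismProperty.colimitsOfShape_colimMap _ ?_
  rintro ⟨d⟩
  exact MorphismProperty.ofHoms_iff _ _ |>.2 ⟨⟨d.1.1, c d.1⟩, rfl⟩

variable {R : A} {𝒦 : Set (Under R)}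

/-- Problems are solved one at a time: if every choice for the next problem led to a covered map,
that case distinction would show the present map to be covered. -/
theorem exists_not_isCovered_finset {g : R ⟶ K} (hg : ¬ C.IsCovered 𝒦 g)
    (T : Finset (C.Problem K)) :
    ∃ c : ∀ d : C.Problem K, C.J d.1, ¬ C.IsCovered 𝒦 (g ≫ choiceInl c T) := by
  classical
  induction T using Finset.induction_on with
  | empty =>
    -- A problem for an empty cone would cover `g` vacuously.
    have (d : C.Problem K) : Nonempty (C.J d.1) := by
      by_contra h
      rw [not_nonempty_iff] at h
      exact hg (.step _ d.1 d.2 fun j => h.elim j)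
    refine ⟨fun d => Classical.arbitrary _, fun h => hg ?_⟩
    obtain ⟨u, hu⟩ := exists_choiceInl_comp (fun d : C.Problem K => Classical.arbitrary (C.J d.1))
      (∅ : Finset (C.Problem K)) (𝟙 K) (by simp)
    have := h.comp u
    rwa [Category.assoc, hu, Category.comp_id] at this
  | insert d T hd ih =>
    obtain ⟨c, hc⟩ := ih
    by_contra! H
    refine hc (.step _ d.1 (d.2 ≫ choiceInl c T) fun j => ?_)
    have := H (Function.update c d j)
    obtain ⟨u, hu⟩ := exists_choiceInl_comp (Function.update c d j)
      (insert d T : Finset (C.Problem K))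
      (choiceInl c T ≫ pushout.inl (d.2 ≫ choiceInl c T) (C.a d.1 j)) (by
        intro d' hd'
        by_cases h : d' = d
        · subst h
          -- The index is generalized because the updated choice at `d'` equals `j` only
          -- propositionally, and the type of `b` depends on it.
          have key : ∀ j', j' = j → ∃ b, C.a d'.1 j' ≫ b =
              d'.2 ≫ choiceInl c T ≫ pushout.inl (d'.2 ≫ choiceInl c T) (C.a d'.1 j) := by
            rintro _ rfl
            exact ⟨pushout.inr _ _, by rw [← pushout.condition, Category.assoc]⟩
          exact key _ (Function.update_self _ _ _)
        · rw [Function.update_of_ne h]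
          obtain ⟨b, hb⟩ := exists_comp_choiceInl c (S := T) (d := d') (by simpa [h] using hd')
          exact ⟨b ≫ pushout.inl _ _, by rw [reassoc_of% hb]⟩)
    have := this.comp u
    rwa [Category.assoc, hu, ← Category.assoc] at this

theorem exists_not_isCovered (hsrc : ∀ i, IsFinitelyPresentable.{v} (C.src i))
    (hepi : ∀ i j, Epi (C.a i j)) (hfin : ∀ i, Finite (C.J i))
    (h𝒦 : ∀ k ∈ 𝒦, liftsAgainstFilteredColimits k.hom) {g : R ⟶ K}
    (hg : ¬ C.IsCovered 𝒦 g) :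
    ∃ c : ∀ d : C.Problem K, C.J d.1, ¬ C.IsCovered 𝒦 (g ≫ choiceInl c Set.univ) := by
  choose γ hγ using exists_not_isCovered_finset hg
  -- On each finite `S`, this `c` agrees with `γ T` for some finite `T ⊇ S`.
  obtain ⟨c, hc⟩ := Finset.rado_selection γ
  refine ⟨c, fun h => ?_⟩
  have (S : Set (C.Problem K)) : Epi (choiceInl c S) := epi_choiceInl c S hepi
  have mono {S T : Set (C.Problem K)} (hST : S ⊆ T) :
      ∃ u, choiceInl c S ≫ u = choiceInl c T :=
    exists_choiceInl_comp c S _ fun d hd => exists_comp_choiceInl c (hST hd)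
  -- The pushout for all problems is the filtered colimit of those for finite `S`, so some finite
  -- stage would already be covered. It maps to the pushout for `γ T`, which is not.
  obtain ⟨S, h₀, hS⟩ := h.exists_of_isColimit hsrc hepi hfin h𝒦
    (isColimitEpiDiagram (fun S : Finset (C.Problem K) => choiceInl c S)
      (fun S T hST => mono (Finset.coe_subset.2 (leOfHom hST)))
      (choiceInl c Set.univ) (fun S => mono (Set.subset_univ _)) (fun {Y} h H =>
        exists_choiceInl_comp c _ _ fun d _ => by
          obtain ⟨u, hu⟩ := H {d}
          obtain ⟨b, hb⟩ := exists_comp_choiceInl c (S := ({d} : Finset _)) (d := d) (by simp)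
          exact ⟨b ≫ u, by rw [reassoc_of% hb, hu]⟩)) (j := ∅) (g ≫ toEpiDiagram _ _ _)
    (by rw [Category.assoc, toEpiDiagram_ι_app])
  rw [Category.assoc, toEpiDiagram_map] at hS
  replace hS : C.IsCovered 𝒦 (g ≫ choiceInl c S) := hS
  obtain ⟨T, hST, hT⟩ := hc S
  obtain ⟨u, hu⟩ := exists_choiceInl_comp c S (choiceInl (γ T) T) fun d hd => by
    rw [hT d hd]
    exact exists_comp_choiceInl (γ T) (hST hd)
  refine hγ T ?_
  rw [← hu, ← Category.assoc]
  exact hS.comp u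

end Choice

end ConeFamily

/-! ### Uncovered local forms and compactness of `Spec R`. -/

namespace ConeFamily

section Pts

variable {A : Type u} [Category.{v} A] {C : ConeFamily A} {R : A}

/-- The point of the spectrum given by a local form. -/
def LocalForm.toSpec (p : C.LocalForm R) : C.Spec R :=
  Quotient.mk (C.localFormSetoid R) p

theorem toSpec_mem_pts_iff {K : A} {k : R ⟶ K} {p : C.LocalForm R} :
    p.toSpec ∈ C.pts k ↔ ∃ u : K ⟶ p.pt, k ≫ u = p.hom := by
  constructor
  · rintro ⟨q, hq, u, hu⟩
    obtain ⟨e, he⟩ := Quotient.exact hq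
    exact ⟨u ≫ e.hom, by rw [reassoc_of% hu, he]⟩
  · rintro ⟨u, hu⟩
    exact ⟨p, rfl, u, hu⟩

end Pts

section Sequence

variable {A : Type u} [Category.{v} A] [HasColimits A] {C : ConeFamily A} {R : A}
  {𝒦 : Set (Under R)}

/-- The pushout of an object under `R` along the choices `c` for all maps from sources of cones. -/
noncomputable abbrev choiceUnder (k : Under R) (c : ∀ d : C.Problem k.right, C.J d.1) : Under R :=
  Under.mk (k.hom ≫ choiceInl c Set.univ)

/-- A sequence of objects under `R`, starting with `R`, that are not covered by `𝒦`, each term of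
which solves all problems with values in the preceding one. -/
noncomputable def uncoveredSequence
    (h : ∀ k : Under R, ¬ C.IsCovered 𝒦 k.hom →
      ∃ c : ∀ d : C.Problem k.right, C.J d.1, ¬ C.IsCovered 𝒦 (choiceUnder k c).hom)
    (hR : ¬ C.IsCovered 𝒦 (𝟙 R)) : ℕ → {k : Under R // ¬ C.IsCovered 𝒦 k.hom}
  | 0 => ⟨Under.mk (𝟙 R), hR⟩
  | n + 1 =>
    let k := uncoveredSequence h hR n
    ⟨choiceUnder k.1 (h k.1 k.2).choose, (h k.1 k.2).choose_spec⟩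

theorem exists_localForm_of_not_isCovered (hsrc : ∀ i, IsFinitelyPresentable.{v} (C.src i))
    (hepi : ∀ i j, Epi (C.a i j)) (hfin : ∀ i, Finite (C.J i))
    (h𝒦 : ∀ k ∈ 𝒦, liftsAgainstFilteredColimits k.hom) (hR : ¬ C.IsCovered 𝒦 (𝟙 R)) :
    ∃ p : C.LocalForm R, ∀ k ∈ 𝒦, ∀ u : k.right ⟶ p.pt, k.hom ≫ u ≠ p.hom := by
  have h (k : Under R) (hk : ¬ C.IsCovered 𝒦 k.hom) :
      ∃ c : ∀ d : C.Problem k.right, C.J d.1, ¬ C.IsCovered 𝒦 (choiceUnder k c).hom :=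
    exists_not_isCovered hsrc hepi hfin h𝒦 hk
  let s := uncoveredSequence h hR
  let c (n : ℕ) : ∀ d : C.Problem (s n).1.right, C.J d.1 := (h (s n).1 (s n).2).choose
  let f (n : ℕ) : (s n).1.right ⟶ (s (n + 1)).1.right := choiceInl (c n) Set.univ
  let F : ℕ ⥤ A := Functor.ofSequence f
  -- The filtered diagrams and transfinite compositions in use are indexed in universe `v`, so `ℕ`
  -- is replaced by an isomorphic order there.
  let e := orderIsoShrink.{v} ℕ
  let g (n : ℕ) : R ⟶ F.obj n := (s n).1.hom
  have hF (n : ℕ) : F.map (homOfLE n.le_succ) = f n := Functor.ofSequence_map_homOfLE_succ f n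
  have : HasColimitsOfShape ℕ A := hasColimitsOfShape_of_equivalence e.equivalence.symm
  let L := colimit F
  have hg (n : ℕ) : g n ≫ colimit.ι F n = colimit.ι F 0 := by
    induction n with
    | zero => exact Category.id_comp _
    | succ n ih =>
      rw [← ih, ← colimit.w F (homOfLE n.le_succ), hF]
      exact Category.assoc _ _ _
  let ι : e.symm.equivalence.functor ⋙ F ⟶ (Functor.const _).obj L :=
    ((colimit.cocone F).whisker e.symm.equivalence.functor).ι
  have hι : IsColimit (Cocone.mk L ι) :=
    (Functor.Final.isColimitWhiskerEquiv e.symm.equivalence.functor _).symm (colimit.isColimit F)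
  have hloc : C.localization (colimit.ι F 0) := by
    refine MorphismProperty.transfiniteCompositionsOfShape_le_transfiniteCompositions _
      (Shrink.{v} ℕ) _ (MorphismProperty.TransfiniteCompositionOfShape.ofOrderIso (J := ℕ)
        { F := F
          isoBot := Iso.refl _
          incl := (colimit.cocone F).ι
          isColimit := colimit.isColimit F
          fac := Category.id_comp _
          map_mem := fun n _ => ?_ } e.symm).mem
    have : F.map (homOfLE (Order.le_succ n)) = f n := hF n
    rw [this]
    exact choiceInl_mem_pushouts _ _
  refine ⟨⟨L, colimit.ι F 0, hloc, fun i x => ?_⟩, fun k hk u hu => ?_⟩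
  · have := hsrc i
    -- A problem with values in the colimit comes from a stage and is solved at the next one.
    obtain ⟨j, w, hw⟩ := IsFinitelyPresentable.exists_hom_of_isColimit hι x
    obtain ⟨b, hb⟩ := exists_comp_choiceInl (c (e.symm j)) (Set.mem_univ ⟨i, w⟩)
    refine ⟨_, b ≫ colimit.ι F (e.symm j + 1), ?_⟩
    have hf (n : ℕ) : f n ≫ colimit.ι F (n + 1) = colimit.ι F n := by
      rw [← hF n]
      exact colimit.w F (homOfLE n.le_succ)
    exact ((reassoc_of% hb) (colimit.ι F (e.symm j + 1))).trans
      ((Category.assoc _ _ _).trans (congr(w ≫ $(hf _)).trans hw))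
  · obtain ⟨j, h₀, w, hw, -⟩ := h𝒦 k hk _ _ _ ι hι (e 0) (g (e.symm (e 0))) u
      (hu.trans (hg _).symm)
    refine (s (e.symm j)).2 (.base _ k hk w (hw.trans ?_))
    -- Stated for `m = 0` since `e.symm (e 0)` is treated as only propositionally `0`.
    have h₁ : ∀ (m : ℕ), m = 0 → ∀ n (l : m ⟶ n), g m ≫ F.map l = g n := by
      rintro _ rfl n l
      induction n with
      | zero => exact Category.id_comp _
      | succ n ih =>
        have : l = homOfLE n.zero_le ≫ homOfLE n.le_succ := rfl
        rw [this, Functor.map_comp, reassoc_of% ih, hF]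
        rfl
    exact h₁ _ (by simp) _ (e.symm.equivalence.functor.map h₀)

theorem exists_finite_of_localForm (hsrc : ∀ i, IsFinitelyPresentable.{v} (C.src i))
    (hepi : ∀ i j, Epi (C.a i j)) (hfin : ∀ i, Finite (C.J i))
    (h𝒦 : ∀ k ∈ 𝒦, liftsAgainstFilteredColimits k.hom)
    (hcover : ∀ p : C.LocalForm R, ∃ k ∈ 𝒦, ∃ u : k.right ⟶ p.pt, k.hom ≫ u = p.hom) :
    ∃ 𝒦' ⊆ 𝒦, 𝒦'.Finite ∧ ∀ (P : A) (_ : C.IsLocalObj P) (h : R ⟶ P),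
      ∃ k ∈ 𝒦', ∃ u : k.right ⟶ P, k.hom ≫ u = h := by
  by_cases hR : C.IsCovered 𝒦 (𝟙 R)
  · simpa using hR.exists_finite_of_isLocalObj hfin
  · obtain ⟨p, hp⟩ := exists_localForm_of_not_isCovered hsrc hepi hfin h𝒦 hR
    obtain ⟨k, hk, u, hu⟩ := hcover p
    exact (hp k hk u hu).elim

theorem compactSpace_spec (hsrc : ∀ i, IsFinitelyPresentable.{v} (C.src i))
    (htgt : ∀ i j, IsFinitelyPresentable.{v} (C.tgt i j))
    (hepi : ∀ i j, Epi (C.a i j)) (hfin : ∀ i, Finite (C.J i)) : CompactSpace (C.Spec R) := by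
  -- By Alexander's subbase theorem, covers by distinguished sets suffice.
  refine compactSpace_generateFrom rfl fun P hP hcov => ?_
  have hcov' (p : C.LocalForm R) : ∃ U ∈ P, p.toSpec ∈ U := by
    rw [← Set.mem_sUnion, hcov]
    exact Set.mem_univ _
  obtain ⟨𝒦', h₁, h₂, h₃⟩ := exists_finite_of_localForm
    (𝒦 := {k : Under R | C.finiteLocalization k.hom ∧ C.pts k.hom ∈ P}) hsrc hepi hfin
    (fun k hk => finiteLocalization_le_liftsAgainstFilteredColimits C hsrc htgt _ hk.1)
    (fun p => by
      obtain ⟨U, hU, hp⟩ := hcov' p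
      obtain ⟨K, k, hk, rfl⟩ := hP hU
      exact ⟨Under.mk k, ⟨hk, hU⟩, toSpec_mem_pts_iff.1 hp⟩)
  refine ⟨(fun k => C.pts k.hom) '' 𝒦', ?_, h₂.image _, ?_⟩
  · rintro _ ⟨k, hk, rfl⟩
    exact (h₁ hk).2
  · refine Set.eq_univ_of_forall fun x => ?_
    obtain ⟨p, rfl⟩ : ∃ p : C.LocalForm R, p.toSpec = x := Quotient.exists_rep x
    obtain ⟨k, hk, u, hu⟩ := h₃ p.pt p.isLocal p.hom
    exact ⟨_, ⟨k, hk, rfl⟩, toSpec_mem_pts_iff.2 ⟨u, hu⟩⟩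

end Sequence

end ConeFamily

/-! ### A small preorder of finite extensions and its ideals. -/

namespace ConeFamily

section Extension

variable {A : Type u} [Category.{v} A] [HasPushouts A] (C : ConeFamily A) (R : A)

/-- The objects under `R` obtained by `n` successive pushouts of components, with a small set of
indices. -/
noncomputable def extensionStage : ℕ → Σ T : Type v, T → Under R
  | 0 => ⟨PUnit, fun _ => Under.mk (𝟙 R)⟩
  | n + 1 =>
    ⟨Σ (t : (extensionStage n).1) (i : C.I) (_ : C.src i ⟶ ((extensionStage n).2 t).right), C.J i,
      fun x => Under.mk
        (((extensionStage n).2 x.1).hom ≫ pushout.inl x.2.2.1 (C.a x.2.1 x.2.2.2))⟩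

/-- A small set of representatives for the finite localizations of `R`. -/
def Extension : Type v := Σ n, (C.extensionStage R n).1

variable {C R}

namespace Extension

/-- The object under `R` that corresponds to an element of `C.Extension R`. -/
noncomputable def under (t : C.Extension R) : Under R := (C.extensionStage R t.1).2 t.2

/-- The identity of `R`. -/
def trivial : C.Extension R := ⟨0, PUnit.unit⟩

/-- The pushout of `t` along a component. -/
noncomputable def extend (t : C.Extension R) (i : C.I) (f : C.src i ⟶ t.under.right) (j : C.J i) :
    C.Extension R :=
  ⟨t.1 + 1, t.2, i, f, j⟩

theorem induction {motive : C.Extension R → Prop} (h₀ : motive trivial)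
    (h₁ : ∀ t i f j, motive t → motive (extend t i f j)) (t : C.Extension R) : motive t := by
  obtain ⟨n, t⟩ := t
  induction n with
  | zero => exact h₀
  | succ n ih =>
    obtain ⟨t, i, f, j⟩ := t
    exact h₁ ⟨n, t⟩ i f j (ih t)

theorem epi_hom (hepi : ∀ i j, Epi (C.a i j)) (t : C.Extension R) : Epi t.under.hom := by
  induction t using induction with
  | h₀ => exact inferInstanceAs (Epi (𝟙 R))
  | h₁ t i f j ih =>
    have := hepi i j
    exact inferInstanceAs (Epi (t.under.hom ≫ pushout.inl f (C.a i j)))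

theorem liftsAgainstFilteredColimits_hom (hsrc : ∀ i, IsFinitelyPresentable.{v} (C.src i))
    (htgt : ∀ i j, IsFinitelyPresentable.{v} (C.tgt i j)) (t : C.Extension R) :
    liftsAgainstFilteredColimits t.under.hom := by
  induction t using induction with
  | h₀ => exact MorphismProperty.id_mem _ R
  | h₁ t i f j ih =>
    exact MorphismProperty.comp_mem _ _ _ ih (MorphismProperty.of_isPushout
      (IsPushout.of_hasPushout f (C.a i j))
      (liftsAgainstFilteredColimits_of_isFinitelyPresentable _ (hsrc i) (htgt i j)))

/-- The maps out of `R` that factor through `t`. -/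
def Factors (t : C.Extension R) {P : A} (h : R ⟶ P) : Prop := ∃ u, t.under.hom ≫ u = h

theorem Factors.comp {t : C.Extension R} {P Q : A} {h : R ⟶ P} (ht : t.Factors h) (k : P ⟶ Q) :
    t.Factors (h ≫ k) := by
  obtain ⟨u, rfl⟩ := ht
  exact ⟨u ≫ k, (Category.assoc _ _ _).symm⟩

theorem factors_trivial {P : A} (h : R ⟶ P) : (trivial : C.Extension R).Factors h :=
  ⟨h, Category.id_comp h⟩

theorem factors_extend_iff {t : C.Extension R} {i : C.I} {f : C.src i ⟶ t.under.right}
    {j : C.J i} {P : A} {h : R ⟶ P} :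
    (t.extend i f j).Factors h ↔ ∃ u, t.under.hom ≫ u = h ∧ ∃ b, C.a i j ≫ b = f ≫ u := by
  constructor
  · rintro ⟨w, hw⟩
    exact ⟨pushout.inl _ _ ≫ w, (Category.assoc _ _ _).symm.trans hw, pushout.inr _ _ ≫ w,
      pushout.condition_assoc _ |>.symm⟩
  · rintro ⟨u, hu, b, hb⟩
    refine ⟨pushout.desc u b hb.symm, ?_⟩
    exact (Category.assoc _ _ _).trans ((congr(t.under.hom ≫ $(pushout.inl_desc _ _ _))).trans hu)

instance : Preorder (C.Extension R) where
  le s t := s.Factors t.under.hom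
  le_refl t := ⟨𝟙 _, Category.comp_id _⟩
  le_trans s t w hst htw := by
    obtain ⟨u, hu⟩ := htw
    exact hu ▸ hst.comp u

theorem le_def {s t : C.Extension R} : s ≤ t ↔ s.Factors t.under.hom := Iff.rfl

theorem Factors.of_le {s t : C.Extension R} {P : A} {h : R ⟶ P} (ht : t.Factors h) (hst : s ≤ t) :
    s.Factors h := by
  obtain ⟨u, rfl⟩ := ht
  exact Factors.comp hst u

theorem le_extend (t : C.Extension R) (i : C.I) (f : C.src i ⟶ t.under.right) (j : C.J i) :
    t ≤ t.extend i f j :=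
  ⟨pushout.inl f (C.a i j), rfl⟩

/-- The steps that build `t` from `R` are repeated on top of `s`. Since `R ⟶ t` is epi, maps under
`R` out of `t` are unique, so the solutions fit together. -/
theorem exists_isLeast_upper_bound (hepi : ∀ i j, Epi (C.a i j)) (s t : C.Extension R) :
    ∃ w, s ≤ w ∧ t ≤ w ∧ ∀ {P : A} {h : R ⟶ P}, s.Factors h → t.Factors h → w.Factors h := by
  induction t using induction with
  | h₀ => exact ⟨s, le_rfl, factors_trivial _, fun h _ => h⟩
  | h₁ t i f j ih =>
    obtain ⟨w, hsw, ⟨v, hv⟩, hw⟩ := ih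
    refine ⟨w.extend i (f ≫ v) j, hsw.trans (le_extend _ _ _ _), ?_, fun {P h} hs ht => ?_⟩
    · rw [le_def, factors_extend_iff]
      exact ⟨v ≫ pushout.inl (f ≫ v) (C.a i j), (reassoc_of% hv) _, pushout.inr (f ≫ v) (C.a i j),
        pushout.condition.symm.trans (Category.assoc _ _ _)⟩
    · rw [factors_extend_iff] at ht ⊢
      obtain ⟨u, hu, b, hb⟩ := ht
      obtain ⟨u', hu'⟩ := hw hs ⟨u, hu⟩
      refine ⟨u', hu', b, ?_⟩
      have := epi_hom hepi t
      have e : v ≫ u' = u := by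
        rw [← cancel_epi t.under.hom, reassoc_of% hv, hu', hu]
      rw [hb, Category.assoc, e]

/-- The extensions through which all members of a family of maps out of `R` factor. -/
def idealOfMaps (hepi : ∀ i j, Epi (C.a i j)) {ι : Sort*} {P : ι → A} (h : ∀ x, R ⟶ P x) :
    Order.Ideal (C.Extension R) where
  carrier := {t | ∀ x, t.Factors (h x)}
  lower' _ _ hst ht x := (ht x).of_le hst
  nonempty' := ⟨trivial, fun _ => factors_trivial _⟩
  directed' s hs t ht := by
    obtain ⟨w, hsw, htw, hw⟩ := exists_isLeast_upper_bound hepi s t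
    exact ⟨w, fun x => hw (hs x) (ht x), hsw, htw⟩

/-- The map `l` is initial among the maps out of `R` that factor through all members of `I`. -/
structure IsUniversal (I : Order.Ideal (C.Extension R)) {L : A} (l : R ⟶ L) : Prop where
  epi : Epi l
  factors : ∀ t ∈ I, t.Factors l
  exists_comp : ∀ {Z : A} (h : R ⟶ Z), (∀ t ∈ I, t.Factors h) → ∃ u, l ≫ u = h

instance (I : Order.Ideal (C.Extension R)) : Nonempty I := I.nonempty.to_subtype

instance (I : Order.Ideal (C.Extension R)) : IsDirectedOrder I where
  directed s t := by
    obtain ⟨w, hw, hsw, htw⟩ := I.directed s.1 s.2 t.1 t.2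
    exact ⟨⟨w, hw⟩, hsw, htw⟩

/-- The diagram of the members of `I`. -/
noncomputable def diagram (hepi : ∀ i j, Epi (C.a i j)) (I : Order.Ideal (C.Extension R)) : I ⥤ A :=
  have (t : I) : Epi t.1.under.hom := epi_hom hepi t.1
  epiDiagram (fun t : I => t.1.under.hom) fun _ _ h => leOfHom h

namespace IsUniversal

variable {I : Order.Ideal (C.Extension R)} {L : A} {l : R ⟶ L}

theorem exists_lift (hepi : ∀ i j, Epi (C.a i j)) (hl : IsUniversal I l) {S : A}
    (hS : IsFinitelyPresentable.{v} S) (f : S ⟶ L) :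
    ∃ t ∈ I, ∃ (w : S ⟶ t.under.right) (u : t.under.right ⟶ L),
      t.under.hom ≫ u = l ∧ w ≫ u = f := by
  have (t : I) : Epi t.1.under.hom := epi_hom hepi t.1
  have := hl.epi
  obtain ⟨t, w, hw⟩ := IsFinitelyPresentable.exists_hom_of_isColimit
    (isColimitEpiDiagram (fun t : I => t.1.under.hom) (fun _ _ h => leOfHom h) l
      (fun t => hl.factors t.1 t.2) fun h H => hl.exists_comp h fun t ht => H ⟨t, ht⟩) f
  exact ⟨t.1, t.2, w, _, toEpiDiagram_ι_app (fun t : I => t.1.under.hom)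
    (fun _ _ h => leOfHom h) l (fun t => hl.factors t.1 t.2) t, hw⟩

/-- The top of a lifting square comes from some `t ∈ I`. The square says that `l ≫ φ` factors
through the extension of `t` by `a_ij`, so this extension lies in `I`, and `l` factors through it
too. That factorization contains the lift. -/
theorem admissible (hepi : ∀ i j, Epi (C.a i j)) (hsrc : ∀ i, IsFinitelyPresentable.{v} (C.src i))
    (hl : IsUniversal I l) {P : A} {φ : L ⟶ P} (hI : ∀ t, t.Factors (l ≫ φ) → t ∈ I) :
    C.admissible φ := by
  rintro _ _ _ ⟨⟨i, j⟩⟩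
  refine ⟨fun {f g} sq => ?_⟩
  obtain ⟨t, -, w, u, hu, rfl⟩ := hl.exists_lift hepi (hsrc i) f
  have hmem : t.extend i w j ∈ I := hI _ <| factors_extend_iff.2
    ⟨u ≫ φ, by rw [reassoc_of% hu], g, by rw [← sq.w, Category.assoc]⟩
  obtain ⟨u', hu', b, hb⟩ := factors_extend_iff.1 (hl.factors _ hmem)
  have := epi_hom hepi t
  have e : u' = u := by rw [← cancel_epi t.under.hom, hu', hu]
  subst e
  have := hepi i j
  exact ⟨⟨⟨b, hb, by rw [← cancel_epi (C.a i j), reassoc_of% hb, ← sq.w, Category.assoc]⟩⟩⟩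

end IsUniversal

/-- An object with the universal property `IsUniversal`. -/
noncomputable def colim [HasColimits A] (hepi : ∀ i j, Epi (C.a i j))
    (I : Order.Ideal (C.Extension R)) : A :=
  colimit (diagram hepi I)

theorem exists_isUniversal [HasColimits A] (hepi : ∀ i j, Epi (C.a i j))
    (I : Order.Ideal (C.Extension R)) :
    ∃ l : R ⟶ colim hepi I, IsUniversal I l := by
  have (t : I) : Epi t.1.under.hom := epi_hom hepi t.1
  let e (t : I) : R ⟶ (diagram hepi I).obj t :=
    toEpiDiagram (fun t : I => t.1.under.hom) (fun _ _ h => leOfHom h) t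
  have (t : I) : Epi (e t) := epi_hom hepi t.1
  let t₀ : I := Classical.arbitrary I
  have key (t : I) : e t ≫ colimit.ι (diagram hepi I) t = e t₀ ≫ colimit.ι (diagram hepi I) t₀ :=
    toEpiDiagram_comp_eq _ _ (colimit.cocone (diagram hepi I)) t t₀
  change ∃ l : R ⟶ colimit (diagram hepi I), IsUniversal I l
  refine ⟨e t₀ ≫ colimit.ι (diagram hepi I) t₀, ⟨?_, fun t ht => ⟨_, key ⟨t, ht⟩⟩, ?_⟩⟩
  · refine ⟨fun {Z} p q h => colimit.hom_ext fun t => ?_⟩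
    rw [← cancel_epi (e t)]
    simpa only [Category.assoc] using
      congr($(key t) ≫ p).trans (h.trans congr($((key t).symm) ≫ q))
  · intro Z h H
    refine ⟨colimit.desc (diagram hepi I) ⟨Z, epiDiagramι _ _ h fun t => H t.1 t.2⟩, ?_⟩
    rw [Category.assoc, colimit.ι_desc]
    exact toEpiDiagram_ι_app _ _ _ _ t₀

end Extension

theorem IsLocalObj.of_admissible {A : Type u} [Category.{v} A] {C : ConeFamily A} {P Q : A}
    (hP : C.IsLocalObj P) {φ : Q ⟶ P} (hφ : C.admissible φ) : C.IsLocalObj Q := by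
  intro i f
  obtain ⟨j, g, hg⟩ := hP i (f ≫ φ)
  have := hφ (C.a i j)
    (MorphismProperty.ofHoms.mk (f := fun p : Sigma C.J => C.a p.1 p.2) ⟨i, j⟩)
  have sq : CommSq f (C.a i j) φ g := ⟨hg.symm⟩
  exact ⟨j, sq.lift, sq.fac_left⟩

end Extension

end ConeFamily

/-! ### Stalks of sheafifications. -/

section StalkSheafify

/-- A left adjoint on presheaves whose right adjoint takes values in sheaves inverts the units of
the sheafification. -/
theorem isIso_map_toSheafify {E : Type*} [Category E] {J : GrothendieckTopology E} {A : Type*}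
    [Category A] [HasWeakSheafify J A] {B : Type*} [Category B] {S : (Eᵒᵖ ⥤ A) ⥤ B}
    {G : B ⥤ Eᵒᵖ ⥤ A} (adj : S ⊣ G) (hG : ∀ Z, Presheaf.IsSheaf J (G.obj Z)) (F : Eᵒᵖ ⥤ A) :
    IsIso (S.map (toSheafify J F)) := by
  let ψ : S.obj (sheafify J F) ⟶ S.obj F :=
    (adj.homEquiv _ _).symm (sheafifyLift J (adj.homEquiv F _ (𝟙 _)) (hG _))
  have h₁ : S.map (toSheafify J F) ≫ ψ = 𝟙 _ := by
    rw [← Adjunction.homEquiv_naturality_left_symm, toSheafify_sheafifyLift,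
      Equiv.symm_apply_apply]
  refine ⟨ψ, h₁, ?_⟩
  apply (adj.homEquiv _ _).injective
  apply sheafify_hom_ext _ _ _ (hG _)
  rw [← Adjunction.homEquiv_naturality_left, ← Adjunction.homEquiv_naturality_left,
    reassoc_of% h₁, Category.comp_id]

variable {A : Type u} [Category.{v} A] [HasColimits A] [HasTerminal A]

/-- Sheafification does not change the stalks. -/
theorem isIso_stalkFunctor_map_toSheafify {T : TopCat.{v}}
    [HasWeakSheafify (Opens.grothendieckTopology T) A] (F : TopCat.Presheaf A T) (x : T) :
    IsIso ((TopCat.Presheaf.stalkFunctor A x).map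
      (toSheafify (Opens.grothendieckTopology T) F)) := by
  classical
  -- The stalk functor is left adjoint to the skyscraper functor, whose values are sheaves.
  exact isIso_map_toSheafify (skyscraperPresheafStalkAdjunction (C := A) x)
    (fun Z => skyscraperPresheaf_isSheaf x Z) F

end StalkSheafify

/-! ### One-point spaces as test objects. -/

section PointSpace

open AlgebraicGeometry

variable {A : Type u} [Category.{v} A] [HasColimits A] [HasTerminal A]

open Classical in
/-- The one-point space with structure sheaf `P`. -/
noncomputable def pointSpace (P : A) : SheafedSpace.{u, v, v} A where
  carrier := TopCat.of PUnit
  presheaf := skyscraperPresheaf (X := TopCat.of PUnit.{v + 1}) PUnit.unit P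
  IsSheaf := skyscraperPresheaf_isSheaf _ _

open Classical in
/-- The stalk of `pointSpace P`. -/
noncomputable def pointSpaceStalkIso (P : A) (y : pointSpace P) :
    (pointSpace P).presheaf.stalk y ≅ P :=
  skyscraperPresheafStalkOfSpecializes (X := TopCat.of PUnit.{v + 1}) PUnit.unit P
    (specializes_rfl : PUnit.unit ⤳ PUnit.unit)

open Classical in
/-- The global sections of `pointSpace P`. -/
noncomputable def pointSpaceΓIso (P : A) : SheafedSpace.Γ.obj (op (pointSpace P)) ≅ P :=
  eqToIso (if_pos (show PUnit.unit ∈ (⊤ : Opens (TopCat.of PUnit.{v + 1})) from True.intro))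

open Classical in
/-- The map from a one-point space to `X` given by a map out of a stalk of `X`. -/
noncomputable def pointSpaceDesc (X : SheafedSpace.{u, v, v} A) (x : X) {P : A}
    (φ : X.presheaf.stalk x ⟶ P) : pointSpace P ⟶ X :=
  InducedCategory.homMk
    { base := TopCat.ofHom (ContinuousMap.const _ x)
      c := StalkSkyscraperPresheafAdjunctionAuxs.toSkyscraperPresheaf x φ }

theorem Γ_map_pointSpaceDesc (X : SheafedSpace.{u, v, v} A) (x : X) {P : A}
    (φ : X.presheaf.stalk x ⟶ P) :
    SheafedSpace.Γ.map (pointSpaceDesc X x φ).op ≫ (pointSpaceΓIso P).hom =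
      X.presheaf.germ ⊤ x True.intro ≫ φ := by
  classical
  have h : (pointSpaceDesc X x φ).hom.c.app (op ⊤) =
      X.presheaf.germ ⊤ x True.intro ≫ φ ≫ (pointSpaceΓIso P).inv :=
    dif_pos (True.intro : x ∈ (⊤ : Opens X))
  refine congr($h ≫ (pointSpaceΓIso P).hom).trans ?_
  rw [Category.assoc, Category.assoc, Iso.inv_hom_id, Category.comp_id]

theorem stalkMap_pointSpaceDesc (X : SheafedSpace.{u, v, v} A) (x : X) {P : A}
    (φ : X.presheaf.stalk x ⟶ P) (y : pointSpace P) :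
    (pointSpaceDesc X x φ).hom.stalkMap y ≫ (pointSpaceStalkIso P y).hom = φ := by
  classical
  refine TopCat.Presheaf.stalk_hom_ext _ fun U hU => ?_
  have h₁ := PresheafedSpace.stalkMap_germ (pointSpaceDesc X x φ).hom U y hU
  have h₂ : (pointSpaceDesc X x φ).hom.c.app (op U) =
      X.presheaf.germ U x hU ≫ φ ≫ eqToHom (if_pos hU).symm := dif_pos hU
  have h₃ := germ_skyscraperPresheafStalkOfSpecializes_hom
    (X := TopCat.of PUnit.{v + 1}) PUnit.unit P (specializes_rfl : PUnit.unit ⤳ PUnit.unit)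
    ((Opens.map (pointSpaceDesc X x φ).hom.base).obj U) hU
  calc
    _ = (X.presheaf.germ U _ hU ≫ (pointSpaceDesc X x φ).hom.stalkMap y) ≫
          (pointSpaceStalkIso P y).hom := (Category.assoc _ _ _).symm
    _ = (X.presheaf.germ U x hU ≫ φ ≫ eqToHom (if_pos hU).symm) ≫ eqToHom (if_pos hU) := by
      rw [h₁, Category.assoc]
      exact congr($h₂ ≫ $h₃)
    _ = X.presheaf.germ U x hU ≫ φ := by simp

end PointSpace

namespace ConeFamily

open AlgebraicGeometry

variable {A : Type u} [Category.{v} A] [HasColimits A] {C : ConeFamily A}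

theorem IsAPMap.comp {X Y Z : SheafedSpace.{u, v, v} A} {f : X ⟶ Y} {g : Y ⟶ Z}
    (hf : C.IsAPMap f) (hg : C.IsAPMap g) : C.IsAPMap (f ≫ g) := by
  intro x
  have := PresheafedSpace.stalkMap.comp f.hom g.hom x
  exact this ▸ MorphismProperty.comp_mem C.components.rlp _ _ (hg _) (hf x)

variable [HasTerminal A]

theorem isAPSpace_pointSpace {P : A} (hP : C.IsLocalObj P) : C.IsAPSpace (pointSpace P) :=
  fun y => hP.of_admissible (MorphismProperty.rlp_of_isIso _ (pointSpaceStalkIso P y).hom)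

theorem isAPMap_pointSpaceDesc (X : SheafedSpace.{u, v, v} A) (x : X) {P : A}
    {φ : X.presheaf.stalk x ⟶ P} (hφ : C.admissible φ) : C.IsAPMap (pointSpaceDesc X x φ) := by
  intro y
  have h := stalkMap_pointSpaceDesc X x φ y
  have : (pointSpaceDesc X x φ).hom.stalkMap y = φ ≫ (pointSpaceStalkIso P y).inv :=
    (Iso.eq_comp_inv _).2 h
  rw [this]
  exact MorphismProperty.comp_mem C.components.rlp _ _ hφ (MorphismProperty.rlp_of_isIso _ _)

/-- Points of a spectrum are determined by their stalks. -/
theorem IsSpectrum.eq_of_germ_comp_eq {R : A} {X : SheafedSpace.{u, v, v} A}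
    {ε : R ⟶ SheafedSpace.Γ.obj (op X)} (hX : C.IsSpectrum R X ε)
    {Y : SheafedSpace.{u, v, v} A} {f : Y ⟶ X} (hf : C.IsAPMap f) (x : X) (y : Y)
    {φ : Y.presheaf.stalk y ⟶ X.presheaf.stalk x} (hφ : C.admissible φ)
    (h : (ε ≫ SheafedSpace.Γ.map f.op) ≫ Y.presheaf.germ ⊤ y True.intro ≫ φ =
      ε ≫ X.presheaf.germ ⊤ x True.intro) :
    f.hom.base y = x := by
  let P := X.presheaf.stalk x
  let g : R ⟶ SheafedSpace.Γ.obj (op (pointSpace P)) :=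
    (ε ≫ X.presheaf.germ ⊤ x True.intro) ≫ (pointSpaceΓIso P).inv
  have h₁ : C.IsAPMap (pointSpaceDesc X x (𝟙 P)) ∧
      ε ≫ SheafedSpace.Γ.map (pointSpaceDesc X x (𝟙 P)).op = g := by
    refine ⟨isAPMap_pointSpaceDesc X x (MorphismProperty.id_mem C.components.rlp _), ?_⟩
    rw [Iso.eq_comp_inv, Category.assoc]
    exact congr(ε ≫ $(Γ_map_pointSpaceDesc X x (𝟙 P))).trans (by rw [Category.comp_id])
  have h₂ : C.IsAPMap (pointSpaceDesc Y y φ ≫ f) ∧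
      ε ≫ SheafedSpace.Γ.map (pointSpaceDesc Y y φ ≫ f).op = g := by
    refine ⟨(isAPMap_pointSpaceDesc Y y hφ).comp hf, ?_⟩
    rw [Iso.eq_comp_inv, op_comp, Functor.map_comp, ← h, Category.assoc, Category.assoc,
      Category.assoc]
    exact congr(ε ≫ SheafedSpace.Γ.map f.op ≫ $(Γ_map_pointSpaceDesc Y y φ))
  -- One map from the one-point space hits `x`, the other `f y`; both induce `g` from `R`.
  have e := (hX.existsUnique _ (isAPSpace_pointSpace (hX.isAPSpace x)) g).unique h₂ h₁
  exact congr(($e).hom.base PUnit.unit)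

end ConeFamily

/-! ### The trace space and its structure sheaf. -/

namespace ConeFamily

section TraceSpace

variable {A : Type u} [Category.{v} A] [HasPushouts A] (C : ConeFamily A) (R : A)

/-- The sets of the extensions of `R` through which a map from `R` to a local object factors. This
is a small model for the spectrum of `R`. -/
def TraceSpace : Type v :=
  {I : Set (C.Extension R) //
    ∃ (P : A) (_ : C.IsLocalObj P) (h : R ⟶ P), I = {t | t.Factors h}}

variable {C R}

namespace TraceSpace

/-- The trace of a map to a local object. -/
def ofHom {P : A} (hP : C.IsLocalObj P) (h : R ⟶ P) : C.TraceSpace R :=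
  ⟨{t | t.Factors h}, P, hP, h, rfl⟩

/-- A local object that represents a given trace. -/
noncomputable def obj (y : C.TraceSpace R) : A := y.2.choose

theorem isLocalObj_obj (y : C.TraceSpace R) : C.IsLocalObj y.obj := y.2.choose_spec.choose

/-- A map to a local object with a given trace. -/
noncomputable def hom (y : C.TraceSpace R) : R ⟶ y.obj := y.2.choose_spec.choose_spec.choose

theorem mem_iff (y : C.TraceSpace R) {t : C.Extension R} : t ∈ y.1 ↔ t.Factors y.hom :=
  Set.ext_iff.1 y.2.choose_spec.choose_spec.choose_spec t

/-- The distinguished open sets. -/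
def basicOpen (t : C.Extension R) : Set (C.TraceSpace R) := {y | t ∈ y.1}

instance : TopologicalSpace (C.TraceSpace R) :=
  TopologicalSpace.generateFrom (Set.range basicOpen)

theorem isOpen_basicOpen (t : C.Extension R) : IsOpen (basicOpen t) :=
  TopologicalSpace.isOpen_generateFrom_of_mem ⟨t, rfl⟩

/-- The extensions that belong to all points of `V`. -/
noncomputable def ideal (hepi : ∀ i j, Epi (C.a i j)) (V : Set (C.TraceSpace R)) :
    Order.Ideal (C.Extension R) :=
  Extension.idealOfMaps hepi fun y : V => y.1.hom

variable {hepi : ∀ i j, Epi (C.a i j)}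

theorem mem_ideal_iff {V : Set (C.TraceSpace R)} {t : C.Extension R} :
    t ∈ ideal hepi V ↔ V ⊆ basicOpen t :=
  ⟨fun h y hy => y.mem_iff.2 (h ⟨y, hy⟩), fun h y => y.1.mem_iff.1 (h y.2)⟩

theorem mem_ideal_ofHom_iff {P : A} (hP : C.IsLocalObj P) (h : R ⟶ P) {t : C.Extension R} :
    t ∈ ideal hepi {ofHom hP h} ↔ t.Factors h :=
  mem_ideal_iff.trans Set.singleton_subset_iff

end TraceSpace

end TraceSpace

namespace TraceSpace

variable {A : Type u} [Category.{v} A] [HasColimits A] {C : ConeFamily A} {R : A}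

theorem compactSpace (hsrc : ∀ i, IsFinitelyPresentable.{v} (C.src i))
    (htgt : ∀ i j, IsFinitelyPresentable.{v} (C.tgt i j))
    (hepi : ∀ i j, Epi (C.a i j)) (hfin : ∀ i, Finite (C.J i)) :
    CompactSpace (C.TraceSpace R) := by
  refine compactSpace_generateFrom rfl fun P hP hcov => ?_
  obtain ⟨𝒦, h₁, h₂, h₃⟩ := exists_finite_of_localForm
    (𝒦 := Extension.under '' {t : C.Extension R | basicOpen t ∈ P}) hsrc hepi hfin
    (by
      rintro _ ⟨t, -, rfl⟩
      exact t.liftsAgainstFilteredColimits_hom hsrc htgt)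
    (fun p => by
      obtain ⟨U, hU, hp⟩ : ofHom p.isLocal p.hom ∈ ⋃₀ P := hcov ▸ Set.mem_univ _
      obtain ⟨t, rfl⟩ := hP hU
      exact ⟨_, ⟨t, hU, rfl⟩, hp⟩)
  have : Nonempty (C.Extension R) := ⟨Extension.trivial⟩
  have h₁' : ∀ k ∈ 𝒦, ∃ t : C.Extension R, basicOpen t ∈ P ∧ t.under = k := fun k hk => h₁ hk
  choose! τ hτ using h₁'
  refine ⟨(fun k => basicOpen (τ k)) '' 𝒦, ?_, h₂.image _, ?_⟩
  · rintro _ ⟨k, hk, rfl⟩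
    exact (hτ k hk).1
  · refine Set.eq_univ_of_forall fun y => ?_
    obtain ⟨k, hk, hky⟩ := h₃ _ y.isLocalObj_obj y.hom
    refine ⟨_, ⟨k, hk, rfl⟩, y.mem_iff.2 ?_⟩
    rw [← (hτ k hk).2] at hky
    exact hky

variable (hepi : ∀ i j, Epi (C.a i j))

/-- The universal map for the extensions that belong to all points of `V`. -/
noncomputable def toSections (V : Set (C.TraceSpace R)) :
    R ⟶ Extension.colim hepi (ideal hepi V) :=
  (Extension.exists_isUniversal hepi (ideal hepi V)).choose

theorem isUniversal_toSections (V : Set (C.TraceSpace R)) :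
    Extension.IsUniversal (ideal hepi V) (toSections hepi V) :=
  (Extension.exists_isUniversal hepi (ideal hepi V)).choose_spec

instance (V : Set (C.TraceSpace R)) : Epi (toSections hepi V) :=
  (isUniversal_toSections hepi V).epi

theorem exists_toSections_comp {V W : Set (C.TraceSpace R)} (h : W ⊆ V) :
    ∃ u, toSections hepi V ≫ u = toSections hepi W :=
  (isUniversal_toSections hepi V).exists_comp _ fun _ ht =>
    (isUniversal_toSections hepi W).factors _ (mem_ideal_iff.2 (h.trans (mem_ideal_iff.1 ht)))

theorem exists_toSections_comp_of_hom ⦃U V : (Opens (C.TraceSpace R))ᵒᵖ⦄ (h : U ⟶ V) :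
    ∃ u, toSections hepi (U.unop : Set (C.TraceSpace R)) ≫ u =
      toSections hepi (V.unop : Set (C.TraceSpace R)) :=
  exists_toSections_comp hepi (leOfHom h.unop)

/-- The structure presheaf. -/
noncomputable def presheaf : TopCat.Presheaf A (TopCat.of (C.TraceSpace R)) :=
  epiDiagram (fun U : (Opens (C.TraceSpace R))ᵒᵖ => toSections hepi (U.unop : Set (C.TraceSpace R)))
    (exists_toSections_comp_of_hom hepi)

/-- The map from `R` to the sections of the structure presheaf. -/
noncomputable def toPresheaf (U : Opens (C.TraceSpace R)) :
    R ⟶ (presheaf hepi).obj (op U) :=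
  toSections hepi (U : Set (C.TraceSpace R))

instance (U : Opens (C.TraceSpace R)) : Epi (toPresheaf hepi U) :=
  inferInstanceAs (Epi (toSections hepi (U : Set (C.TraceSpace R))))

theorem toPresheaf_map {U V : Opens (C.TraceSpace R)} (h : V ⟶ U) :
    toPresheaf hepi U ≫ (presheaf hepi).map h.op = toPresheaf hepi V :=
  toEpiDiagram_map
    (fun U : (Opens (C.TraceSpace R))ᵒᵖ => toSections hepi (U.unop : Set (C.TraceSpace R)))
    (exists_toSections_comp_of_hom hepi) h.op

/-- The map from `R` to the stalks of the structure presheaf. -/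
noncomputable def toStalk (y : TopCat.of (C.TraceSpace R)) : R ⟶ (presheaf hepi).stalk y :=
  toPresheaf hepi ⊤ ≫ (presheaf hepi).germ ⊤ y True.intro

theorem toPresheaf_germ (y : TopCat.of (C.TraceSpace R))
    (U : Opens (TopCat.of (C.TraceSpace R))) (hU : y ∈ U) :
    toPresheaf hepi U ≫ (presheaf hepi).germ U y hU = toStalk hepi y := by
  rw [← toPresheaf_map hepi (homOfLE (le_top : U ≤ ⊤)), Category.assoc]
  exact congr(toPresheaf hepi ⊤ ≫
    $(TopCat.Presheaf.germ_res (presheaf hepi) (homOfLE (le_top : U ≤ ⊤)) y hU))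

theorem exists_germ_comp_eq {T : TopCat.{v}} (F : TopCat.Presheaf A T) (y : T) {Z : A}
    (k : ∀ U : OpenNhds y, F.obj (op U.1) ⟶ Z)
    (hk : ∀ {U V : OpenNhds y} (h : V.1 ⟶ U.1), F.map h.op ≫ k V = k U) :
    ∃ u : F.stalk y ⟶ Z, ∀ (U : Opens T) (hU : y ∈ U), F.germ U y hU ≫ u = k ⟨U, hU⟩ := by
  let s : Cocone ((OpenNhds.inclusion y).op ⋙ F) :=
    { pt := Z
      ι :=
        { app := fun U => k U.unop
          naturality := fun U V i =>
            (hk ((OpenNhds.inclusion y).map i.unop)).trans (Category.comp_id _).symm } }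
  exact ⟨colimit.desc _ s, fun U hU => colimit.ι_desc s (op ⟨U, hU⟩)⟩

theorem exists_toStalk_comp (y : TopCat.of (C.TraceSpace R)) {Z : A} (h : R ⟶ Z)
    (H : ∀ t ∈ ideal hepi {(y : C.TraceSpace R)}, t.Factors h) :
    ∃ u, toStalk hepi y ≫ u = h := by
  have key (U : OpenNhds y) : ∃ u, toPresheaf hepi U.1 ≫ u = h :=
    (isUniversal_toSections hepi (U.1.1 : Set (C.TraceSpace R))).exists_comp h fun t ht =>
      H t (mem_ideal_iff.2 ((Set.singleton_subset_iff.2 U.2).trans (mem_ideal_iff.1 ht)))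
  choose k hk using key
  obtain ⟨u, hu⟩ := exists_germ_comp_eq (presheaf hepi) y k fun {U V} i => by
    rw [← cancel_epi (toPresheaf hepi U.1), hk, ← hk V, ← toPresheaf_map hepi i, Category.assoc]
  refine ⟨u, ?_⟩
  rw [← toPresheaf_germ hepi y ⊤ (Opens.mem_top y), Category.assoc, hu]
  exact hk ⟨⊤, Opens.mem_top y⟩

theorem epi_toStalk (y : TopCat.of (C.TraceSpace R)) : Epi (toStalk hepi y) :=
  ⟨fun {Z} p q h => TopCat.Presheaf.stalk_hom_ext _ fun U hU => by
    rw [← cancel_epi (toPresheaf hepi U), reassoc_of% toPresheaf_germ hepi y U hU,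
      reassoc_of% toPresheaf_germ hepi y U hU, h]⟩

theorem factors_toStalk (y : TopCat.of (C.TraceSpace R)) {t}
    (ht : t ∈ ideal hepi {(y : C.TraceSpace R)}) : t.Factors (toStalk hepi y) := by
  let U : Opens (TopCat.of (C.TraceSpace R)) := ⟨basicOpen t, isOpen_basicOpen t⟩
  have hU : y ∈ U := mem_ideal_iff.1 ht rfl
  rw [← toPresheaf_germ hepi y U hU]
  have : t.Factors (toPresheaf hepi U) :=
    (isUniversal_toSections hepi (basicOpen t)).factors t (mem_ideal_iff.2 subset_rfl)
  exact this.comp _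

/-- Each extension `t` in the trace of `y` is available on the neighbourhood `basicOpen t`, and
every extension available on a neighbourhood of `y` lies in that trace. -/
theorem isUniversal_toStalk (y : TopCat.of (C.TraceSpace R)) :
    Extension.IsUniversal (ideal hepi {(y : C.TraceSpace R)}) (toStalk hepi y) where
  epi := epi_toStalk hepi y
  factors _ ht := factors_toStalk hepi y ht
  exists_comp h H := exists_toStalk_comp hepi y h H

/-- This factors any map from `R` to a local object through a stalk. The second factor is admissible
because the ideal of the stalk consists of exactly the extensions through which `h` factors. -/
theorem exists_admissible_stalk (hsrc : ∀ i, IsFinitelyPresentable.{v} (C.src i)) {P : A}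
    (hP : C.IsLocalObj P) (h : R ⟶ P) :
    ∃ φ : (presheaf hepi).stalk (ofHom hP h : TopCat.of (C.TraceSpace R)) ⟶ P,
      toStalk hepi _ ≫ φ = h ∧ C.admissible φ := by
  have H := isUniversal_toStalk hepi (ofHom hP h : TopCat.of (C.TraceSpace R))
  obtain ⟨φ, hφ⟩ := H.exists_comp h fun t ht => (mem_ideal_ofHom_iff hP h).1 ht
  exact ⟨φ, hφ, H.admissible hepi hsrc fun t ht => (mem_ideal_ofHom_iff hP h).2 (hφ ▸ ht)⟩

theorem isLocalObj_stalk (hsrc : ∀ i, IsFinitelyPresentable.{v} (C.src i))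
    (y : TopCat.of (C.TraceSpace R)) : C.IsLocalObj ((presheaf hepi).stalk y) := by
  obtain ⟨I, P, hP, h, rfl⟩ := y
  obtain ⟨φ, -, hφ⟩ := exists_admissible_stalk hepi hsrc hP h
  exact hP.of_admissible hφ

section Sheafify

open AlgebraicGeometry

variable [HasLimits A]
  [HasWeakSheafify (Opens.grothendieckTopology (TopCat.of (C.TraceSpace R))) A]

/-- The trace space as a space with a sheaf. -/
noncomputable def sheafedSpace : SheafedSpace.{u, v, v} A where
  carrier := TopCat.of (C.TraceSpace R)
  presheaf := sheafify (Opens.grothendieckTopology (TopCat.of (C.TraceSpace R))) (presheaf hepi)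
  IsSheaf := ((presheafToSheaf _ A).obj (presheaf hepi)).property

/-- The stalks of the sheafification. -/
noncomputable def sheafStalkIso (y : TopCat.of (C.TraceSpace R)) :
    (presheaf hepi).stalk y ≅
      (sheafedSpace hepi).presheaf.stalk (X := (sheafedSpace hepi).carrier) y :=
  @asIso _ _ _ _ _ (isIso_stalkFunctor_map_toSheafify (presheaf hepi) y)

theorem isAPSpace_sheafedSpace (hsrc : ∀ i, IsFinitelyPresentable.{v} (C.src i)) :
    C.IsAPSpace (sheafedSpace (C := C) (R := R) hepi) :=
  fun y => (isLocalObj_stalk hepi hsrc y).of_admissible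
    (MorphismProperty.rlp_of_isIso _ (sheafStalkIso hepi y).inv)

/-- The map from `R` to the global sections. -/
noncomputable def toΓ : R ⟶ SheafedSpace.Γ.obj (op (sheafedSpace (C := C) (R := R) hepi)) :=
  toPresheaf hepi ⊤ ≫ (toSheafify (Opens.grothendieckTopology (TopCat.of (C.TraceSpace R)))
    (presheaf hepi)).app (op ⊤)

theorem toΓ_germ (y : TopCat.of (C.TraceSpace R)) :
    toΓ hepi ≫ (sheafedSpace hepi).presheaf.germ ⊤ y True.intro =
      toStalk hepi y ≫ (sheafStalkIso hepi y).hom := by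
  have := TopCat.Presheaf.stalkFunctor_map_germ ⊤ y True.intro
    (toSheafify (Opens.grothendieckTopology (TopCat.of (C.TraceSpace R))) (presheaf hepi))
  exact (Category.assoc _ _ _).trans (congr(toPresheaf hepi ⊤ ≫ $this.symm).trans
    (Category.assoc (toPresheaf hepi ⊤) ((presheaf hepi).germ ⊤ y True.intro) _).symm)

end Sheafify

end TraceSpace

/-! ### Compactness from the universal property. -/

theorem IsSpectrum.compactSpace {A : Type u} [Category.{v} A] [HasLimits A] [HasColimits A]
    {C : ConeFamily A} (hsrc : ∀ i, IsFinitelyPresentable.{v} (C.src i))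
    (htgt : ∀ i j, IsFinitelyPresentable.{v} (C.tgt i j))
    (hepi : ∀ i j, Epi (C.a i j)) (hfin : ∀ i, Finite (C.J i)) {R : A}
    (hA : ∀ T : TopCat.{v}, HasWeakSheafify (Opens.grothendieckTopology T) A)
    {X : AlgebraicGeometry.SheafedSpace.{u, v, v} A}
    {ε : R ⟶ AlgebraicGeometry.SheafedSpace.Γ.obj (op X)} (hX : C.IsSpectrum R X ε) :
    CompactSpace X := by
  have := hA (TopCat.of (C.TraceSpace R))
  obtain ⟨f, ⟨hf, hfε⟩, -⟩ := hX.existsUnique (TraceSpace.sheafedSpace hepi)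
    (TraceSpace.isAPSpace_sheafedSpace hepi hsrc) (TraceSpace.toΓ hepi)
  have : CompactSpace (TraceSpace.sheafedSpace (C := C) (R := R) hepi) :=
    TraceSpace.compactSpace hsrc htgt hepi hfin
  -- A preimage of `x` is the trace of `R ⟶ X_x`.
  have hsurj : Function.Surjective f.hom.base := by
    intro x
    obtain ⟨φ, hφ, hadm⟩ := TraceSpace.exists_admissible_stalk hepi hsrc (hX.isAPSpace x)
      (ε ≫ X.presheaf.germ ⊤ x True.intro)
    let y : TopCat.of (C.TraceSpace R) :=
      TraceSpace.ofHom (hX.isAPSpace x) (ε ≫ X.presheaf.germ ⊤ x True.intro)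
    refine ⟨y, hX.eq_of_germ_comp_eq hf x y (φ := (TraceSpace.sheafStalkIso hepi y).inv ≫ φ)
      (MorphismProperty.comp_mem C.components.rlp _ _ (MorphismProperty.rlp_of_isIso _ _) hadm) ?_⟩
    rw [hfε]
    have := TraceSpace.toΓ_germ hepi y
    refine (Category.assoc _ _ _).symm.trans ?_
    refine congr($this ≫ (TraceSpace.sheafStalkIso hepi y).inv ≫ φ).trans ?_
    rw [Category.assoc, Iso.hom_inv_id_assoc]
    exact hφ
  exact hsurj.compactSpace f.hom.base.hom.continuous

end ConeFamily

theorem mainTheorem7 {A : Type u} [Category.{v} A] [HasLimits A] [HasColimits A]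
    (C : ConeFamily A)
    (hsrc : ∀ i, IsFinitelyPresentable.{v} (C.src i))
    (htgt : ∀ i j, IsFinitelyPresentable.{v} (C.tgt i j))
    (hepi : ∀ i j, Epi (C.a i j))
    (hfin : ∀ i, Finite (C.J i)) (R : A) :
    CompactSpace (C.Spec R) ∧
      ((∀ T : TopCat.{v}, HasWeakSheafify (Opens.grothendieckTopology T) A) →
        ∀ (X : AlgebraicGeometry.SheafedSpace.{u, v, v} A)
          (ε : R ⟶ AlgebraicGeometry.SheafedSpace.Γ.obj (op X)),
          C.IsSpectrum R X ε → CompactSpace X) :=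
  ⟨ConeFamily.compactSpace_spec hsrc htgt hepi hfin,
    fun hA _ _ hX => hX.compactSpace hsrc htgt hepi hfin hA⟩
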